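/- Let $(E,d)$ be a metric space, $\mathbb X\subseteq E$ a Borel subset with its Borel $\sigma$-algebra, and $\mathbb X_\partial=\mathbb X\cup\{\partial\}$ with $\partial\notin E$ an isolated cemetery point. *Killed process.* Let $X^\circ=(X^\circ(t),t\ge0)$ be a time-homogeneous $\mathbb X_\partial$-valued Markov process with right-continuous paths (for example a Borel right process) and laws $(\mathbb P_x,x\in\mathbb X)$ depending measurably on $x$, $\mathbb P_x(X^\circ(0)=x)=1$. Let $\zeta=\inf\{t\ge 0:X^\circ(t)=\partial\}$. Suppose that $\partial$ is absorbing, that $X^\circ$ has left limits in $E$ at all times in $(0,\zeta]\cap(0,\infty)$, that it is absorbed in $\partial$ at the first time a left limit lies in $E\setminus\mathbb X$, or earlier by a jump to $\partial$ from within $\mathbb X$, and that $\mathbb P_x(\zeta<\infty)=1$ for all $x\in\mathbb X$. Let $P^\circ_t(x,\cdot)=\mathbb P_x(X^\circ(t)\in\cdot)$ for $x\in\mathbb X$ and $P^\circ_t(\partial,\cdot)=\delta_\partial$. *Regenerated process.* Let $\kappa$ be a stochastic kernel from $E$ to $\mathbb X$. Starting from $X^\bullet(0)=x\in\mathbb X$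 and $S_0=0$, define inductively: given $X^\bullet$ on $[0,S_n]$, let $X^\circ_n$ be a killed process started from $X^\bullet(S_n)$, with absorption time $\zeta_n$; put $X^\bullet(S_n+t)=X^\circ_n(t)$ for $0\le t<\zeta_n$ and $S_{n+1}=S_n+\zeta_n$, and sample $X^\bullet(S_{n+1})$ from $\kappa(X_n^\circ(\zeta_n-),\cdot)$. Put $X^\bullet(t)=\partial$ for $t\ge S_\infty:=\lim_n S_n$. Let $P^\bullet_t(x,\cdot)$ be the law of $X^\bullet(t)$ when $X^\bullet(0)=x\in\mathbb X$, and $P^\bullet_t(\partial,\cdot)=\delta_\partial$. Let $\widetilde P$ be the kernel on $\mathbb X\times[0,\infty)$ for which $\widetilde P((x,s),\cdot)$ is the law of $(X^\bullet(\zeta),s+\zeta)$ under $X^\bullet(0)=x$, where $\zeta=S_1$. *Intertwining.* Let $\mathbb Y$ be a metric space, $\partial\notin\mathbb Y$, $\mathbb Y_\partial=\mathbb Y\cup\{\partial\}$, let $\phi:\mathbb X\to\mathbb Y$ be Borel measurable with kernel $\Phi(x,\cdot)=\delta_{\phi(x)}$, and let $\Lambda$ be a stochastic kernel from $\mathbb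 Y$ to $\mathbb X$ such that $\Lambda\Phi$ is the identity kernel on $\mathbb Y$. Extend $\phi(\partial)=\partial$ and $\Lambda(\partial,\cdot)=\delta_\partial$. Kernels are composed with transitions ordered from left to right. Put $$Q^\circ_t=\Lambda P^\circ_t\Phi,\qquad Q^\bullet_t=\Lambda P^\bullet_t\Phi,\qquad \widetilde Q=\widetilde\Lambda\widetilde P\widetilde\Phi,$$ where $\widetilde\Lambda((y,s),dx\,dt)=\Lambda(y,dx)\delta_s(dt)$ is a kernel from $\mathbb Y\times[0,\infty)$ to $\mathbb X\times[0,\infty)$ and $\widetilde\Phi((x,t),\cdot)=\delta_{(\phi(x),t)}$. Suppose that $$\Lambda P^\circ_t=Q^\circ_t\Lambda\quad\text{for all }t>0,\qquad\text{and}\qquad \widetilde\Lambda\widetilde P=\widetilde Q\widetilde\Lambda .$$ Then $\Lambda P^\bullet_t=Q^\bullet_t\Lambda$ for all $t\ge0$. -/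

import Mathlib

open MeasureTheory ProbabilityTheory Filter Topology Set
open scoped NNReal ENNReal

noncomputable section

namespace Intertwining

/-! ### Cemetery states -/

section Cemetery

/-- The space `A ∪ {∂}` obtained by adding an isolated cemetery point (topology and `σ`-algebra
are those of the disjoint sum). -/
abbrev Cem (A : Type*) : Type _ := A ⊕ Unit

/-- The cemetery state `∂`. -/
abbrev cem {A : Type*} : Cem A := Sum.inr ()

instance instBorelSpaceCem {A : Type*} [TopologicalSpace A] [MeasurableSpace A] [BorelSpace A] :
    BorelSpace (Cem A) := by
  refine ⟨le_antisymm (fun S hS => ?_) (MeasurableSpace.generateFrom_le fun S hS => ?_)⟩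
  · have h1 : MeasurableSet (Sum.inl ⁻¹' S : Set A) := (measurableSet_sum_iff.1 hS).1
    have hind : borel A = (borel (Cem A)).comap Sum.inl := by
      have := (Topology.IsEmbedding.inl (X := A) (Y := Unit)).isInducing.1
      conv_lhs => rw [this]
      exact borel_comap
    rw [BorelSpace.measurable_eq (α := A), hind] at h1
    obtain ⟨C, hC, hCS⟩ := h1
    have e : S = (C ∩ range Sum.inl) ∪ (S ∩ range Sum.inr) := by
      ext z
      rcases z with a | u
      · have : Sum.inl a ∈ C ↔ Sum.inl a ∈ S := by
          simpa using Set.ext_iff.1 hCS a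
        simp [this]
      · simp
    rw [e]
    have o1 : MeasurableSet[borel (Cem A)] (range (Sum.inl : A → Cem A)) :=
      MeasurableSpace.measurableSet_generateFrom isOpen_range_inl
    have o2 : MeasurableSet[borel (Cem A)] (S ∩ range (Sum.inr : Unit → Cem A)) := by
      refine MeasurableSpace.measurableSet_generateFrom ?_
      refine isOpen_sum_iff.2 ⟨?_, isOpen_discrete _⟩
      have : (Sum.inl ⁻¹' (S ∩ range (Sum.inr : Unit → Cem A)) : Set A) = ∅ := by
        ext a; simp
      rw [this]
      exact isOpen_empty
    exact MeasurableSet.union (MeasurableSet.inter hC o1) o2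
  · exact measurableSet_sum_iff.2 ⟨(isOpen_sum_iff.1 hS).1.measurableSet, trivial⟩

theorem measurableSet_cem {A : Type*} [MeasurableSpace A] : MeasurableSet {z : Cem A | z = cem} :=
  measurableSet_sum_iff.2 ⟨by
    have : (Sum.inl ⁻¹' {z : Cem A | z = cem} : Set A) = ∅ := by ext a; simp
    rw [this]
    exact MeasurableSet.empty, trivial⟩

/-- Extension of a kernel from `A` to `B ∪ {∂}` to a kernel from `A ∪ {∂}` to `B ∪ {∂}`
for which `∂` is absorbing. -/
def withCemetery {A B : Type*} [MeasurableSpace A] [MeasurableSpace B]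
    (k : Kernel A (Cem B)) : Kernel (Cem A) (Cem B) where
  toFun := Sum.elim k (fun _ => Measure.dirac cem)
  measurable' := k.measurable.sumElim measurable_const

/-- A kernel from `A` to `B`, extended by `∂ ↦ δ_∂`. -/
def cemKernel {A B : Type*} [MeasurableSpace A] [MeasurableSpace B]
    (k : Kernel A B) : Kernel (Cem A) (Cem B) :=
  withCemetery (k.map Sum.inl)

end Cemetery

/-! ### Intertwining of kernels

Mathlib composes kernels from right to left: the kernel written `P Q` with transitions ordered
from left to right is `Q ∘ₖ P`. -/

section Kernels

variable {S T : Type*} [MeasurableSpace S] [MeasurableSpace T]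

/-- The intertwining relation `Λ P = Q Λ`. -/
def Intertwines (Λ : Kernel T S) (P : Kernel S S) (Q : Kernel T T) : Prop :=
  P ∘ₖ Λ = Λ ∘ₖ Q

/-- The kernel `Λ P Φ` on `T`. -/
def projected (Λ : Kernel T S) (P : Kernel S S) (Φ : Kernel S T) : Kernel T T :=
  Φ ∘ₖ P ∘ₖ Λ

end Kernels

/-! ### Killed paths -/

section Paths

variable {E : Type*} [MetricSpace E] {X : Set E}

/-- Forget that a point lies in `X`; `∂` is sent to the irrelevant value `x₀`. -/
def toAmbient (x₀ : X) : Cem X → E := Sum.elim (fun x => (x : E)) (fun _ => (x₀ : E))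

/-- The admissible paths of a killed process on `X ⊆ E`: they start in `X`, are right-continuous in
`X ∪ {∂}`, have left limits in `E` as long as they have not been absorbed (including at the
absorption time), and are absorbed in `∂` when a left limit lies in `E \ X`, or earlier. -/
structure IsKilledPath (X : Set E) (w : ℝ≥0 → Cem X) : Prop where
  start_ne : w 0 ≠ cem
  absorbed : ∀ s t, s ≤ t → w s = cem → w t = cem
  right_cont : ∀ t, ContinuousWithinAt w (Ici t) t
  left_lim : ∀ t, 0 < t → (∀ s < t, w s ≠ cem) →
    ∃ l : E, (∀ x₀ : X, Tendsto (fun s => toAmbient x₀ (w s)) (𝓝[<] t) (𝓝 l)) ∧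
      (l ∉ X → w t = cem)

/-- The absorption time `ζ` of a path. -/
def absorptionTime (w : ℝ≥0 → Cem X) : ℝ≥0∞ := ⨅ (t : ℝ≥0) (_ : w t = cem), (t : ℝ≥0∞)

/-- The least multiple of `1 / (n + 1)` that is greater than `t`. -/
def gridAbove (n : ℕ) (t : ℝ≥0) : ℝ≥0 := ((⌊t * ((n : ℝ≥0) + 1)⌋₊ : ℝ≥0) + 1) / ((n : ℝ≥0) + 1)

theorem tendsto_gridAbove (t : ℝ≥0) : Tendsto (fun n => gridAbove n t) atTop (𝓝[≥] t) := by
  have hlt : ∀ n, t ≤ gridAbove n t := fun n => by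
    have hp : (0 : ℝ≥0) < (n : ℝ≥0) + 1 := by positivity
    exact (le_div_iff₀ hp).2 (Nat.lt_floor_add_one _).le
  have hle : ∀ n, gridAbove n t ≤ t + 1 / ((n : ℝ≥0) + 1) := fun n => by
    have hp : (0 : ℝ≥0) < (n : ℝ≥0) + 1 := by positivity
    refine (div_le_iff₀ hp).2 ?_
    rw [add_mul, one_div, inv_mul_cancel₀ hp.ne']
    gcongr
    exact Nat.floor_le (zero_le : 0 ≤ t * ((n : ℝ≥0) + 1))
  refine tendsto_nhdsWithin_iff.2 ⟨?_, Eventually.of_forall hlt⟩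
  refine tendsto_of_tendsto_of_tendsto_of_le_of_le tendsto_const_nhds ?_ hlt hle
  simpa using (tendsto_const_nhds (x := t)).add
    (tendsto_one_div_add_atTop_nhds_zero_nat (𝕜 := ℝ≥0))

end Paths

/-! ### Killed Markov processes -/

section Killed

variable {E : Type*} [MetricSpace E] [MeasurableSpace E]

/-- Transition kernels `P°_t(x, ·) = ℙ_x(X°(t) ∈ ·)`, `P°_t(∂, ·) = δ_∂`, of a process with a
family of laws `(ℙ_x, x ∈ X)`. -/
def transitionOf {X : Set E} {Ω : Type*} [MeasurableSpace Ω] (proc : ℝ≥0 → Ω → Cem X)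
    (law : Kernel X Ω) (t : ℝ≥0) : Kernel (Cem X) (Cem X) :=
  withCemetery (law.map (proc t))

/-- A (time-homogeneous) killed Markov process `X°` on `X ⊆ E`, realized on a measurable space `Ω`
carrying probability measures `(ℙ_x, x ∈ X)`, with `ℙ_x(X°(0) = x) = 1` and `ℙ_x(ζ < ∞) = 1`. -/
structure KilledMarkovProcess (X : Set E) (Ω : Type*) [MeasurableSpace Ω] where
  /-- the process `X°` -/
  proc : ℝ≥0 → Ω → Cem X
  /-- the family `(ℙ_x, x ∈ X)` -/
  law : Kernel X Ω
  measurable_proc : ∀ t, Measurable (proc t)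
  isMarkovKernel_law : IsMarkovKernel law
  isKilledPath : ∀ ω, IsKilledPath X (fun t => proc t ω)
  start_eq : ∀ x : X, ∀ᵐ ω ∂law x, proc 0 ω = Sum.inl x
  /-- Markov property with respect to the natural filtration -/
  markov : ∀ (x : X) (s t : ℝ≥0) (F : Set Ω) (B : Set (Cem X)),
    MeasurableSet[⨆ (u : ℝ≥0) (_ : u ≤ s), MeasurableSpace.comap (proc u) inferInstance] F →
    MeasurableSet B →
    law x (F ∩ {ω | proc (s + t) ω ∈ B}) =
      ∫⁻ ω in F, transitionOf proc law t (proc s ω) B ∂law x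
  absorbed_ae : ∀ x : X, ∀ᵐ ω ∂law x, absorptionTime (fun t => proc t ω) < ∞

namespace KilledMarkovProcess

variable {X : Set E} {Ω : Type*} [MeasurableSpace Ω] (Z : KilledMarkovProcess X Ω)

instance : IsMarkovKernel Z.law := Z.isMarkovKernel_law

/-- The killed transition kernels `P°_t`. -/
def transition (t : ℝ≥0) : Kernel (Cem X) (Cem X) := transitionOf Z.proc Z.law t

/-- The absorption time `ζ`. -/
def lifetime (ω : Ω) : ℝ≥0∞ := absorptionTime (fun t => Z.proc t ω)

/-- The initial state, as a point of `X`. -/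
def start (ω : Ω) : X :=
  (Z.proc 0 ω).getLeft (by
    have h := (Z.isKilledPath ω).start_ne
    generalize Z.proc 0 ω = z at h
    rcases z with x | ⟨⟩
    · rfl
    · exact absurd rfl h)

/-- The left limit `X°(ζ-)`, a point of `E` (where `ζ = ∞`, a null event, the value is
irrelevant). -/
def preKill (ω : Ω) : E :=
  Function.leftLim (fun s => toAmbient (Z.start ω) (Z.proc s ω)) (Z.lifetime ω).toNNReal

theorem inl_start (ω : Ω) : Sum.inl (Z.start ω) = Z.proc 0 ω := Sum.inl_getLeft _ _

theorem measurable_start : Measurable Z.start := by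
  intro A hA
  have : Z.start ⁻¹' A = Z.proc 0 ⁻¹' (Sum.inl '' A) := by
    ext ω
    simp [← Z.inl_start ω]
  rw [this]
  exact Z.measurable_proc 0 (measurableSet_inl_image.2 hA)

theorem lifetime_lt_iff (ω : Ω) (c : ℝ≥0∞) :
    Z.lifetime ω < c ↔ ∃ q : ℚ, ∃ t : ℝ≥0, (t : ℝ) = q ∧ (t : ℝ≥0∞) < c ∧ Z.proc t ω = cem := by
  unfold lifetime absorptionTime
  simp only [iInf_lt_iff]
  constructor
  · rintro ⟨t, ht, htc⟩
    obtain ⟨r, hr1, hr2⟩ := ENNReal.lt_iff_exists_nnreal_btwn.1 htc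
    have h1 : (t : ℝ) < r := by exact_mod_cast hr1
    obtain ⟨q, hq1, hq2⟩ := exists_rat_btwn h1
    have hq0 : (0 : ℝ) ≤ q := t.2.trans hq1.le
    refine ⟨q, ⟨q, hq0⟩, rfl, lt_trans ?_ hr2, (Z.isKilledPath ω).absorbed t _ ?_ ht⟩
    · exact ENNReal.coe_lt_coe.2 hq2
    · exact hq1.le
  · rintro ⟨q, t, -, htc, ht⟩
    exact ⟨t, ht, htc⟩

theorem measurable_lifetime : Measurable Z.lifetime := by
  refine measurable_of_Iio fun c => ?_
  have : Z.lifetime ⁻¹' Iio c =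
      ⋃ q : ℚ, if (Real.toNNReal q : ℝ≥0∞) < c then
        Z.proc (Real.toNNReal q) ⁻¹' {z | z = cem} else ∅ := by
    ext ω
    simp only [mem_preimage, mem_Iio, mem_iUnion]
    constructor
    · intro h
      obtain ⟨q, t, htq, htc, ht⟩ := (Z.lifetime_lt_iff ω c).1 h
      have e : Real.toNNReal q = t := by rw [← htq, Real.toNNReal_coe]
      refine ⟨q, ?_⟩
      rw [e, if_pos htc]
      exact ht
    · rintro ⟨q, h⟩
      split_ifs at h with h'
      · exact lt_of_le_of_lt (iInf₂_le (Real.toNNReal q) h) h'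
      · exact absurd h (by simp)
  rw [this]
  refine MeasurableSet.iUnion fun q => ?_
  split_ifs
  · exact Z.measurable_proc _ measurableSet_cem
  · exact MeasurableSet.empty

variable [BorelSpace E] in
/-- Right-continuity makes the process jointly measurable. -/
theorem measurable_uncurry : Measurable (fun p : ℝ≥0 × Ω => Z.proc p.1 p.2) := by
  have hmeas : ∀ n, Measurable (fun p : ℝ≥0 × Ω => Z.proc (gridAbove n p.1) p.2) := fun n => by
    have hG : Measurable
        (fun q : ℕ × Ω => Z.proc (((q.1 : ℝ≥0) + 1) / ((n : ℝ≥0) + 1)) q.2) :=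
      measurable_from_prod_countable_right fun m =>
        show Measurable (Z.proc (((m : ℝ≥0) + 1) / ((n : ℝ≥0) + 1))) from Z.measurable_proc _
    have hfl : Measurable (fun p : ℝ≥0 × Ω => ⌊p.1 * ((n : ℝ≥0) + 1)⌋₊) :=
      Nat.measurable_floor.comp (measurable_fst.mul_const _)
    simpa only [gridAbove, Function.comp_def] using hG.comp (hfl.prodMk measurable_snd)
  exact measurable_of_tendsto_metrizable hmeas (tendsto_pi_nhds.2 fun p =>
    ((Z.isKilledPath p.2).right_cont p.1).tendsto.comp (tendsto_gridAbove p.1))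

theorem lifetime_pos (ω : Ω) : 0 < Z.lifetime ω := by
  by_contra h0
  have h0 : Z.lifetime ω = 0 := by simpa using h0
  have hk := Z.isKilledPath ω
  have hev : ∀ᶠ s in 𝓝[>] (0 : ℝ≥0), Z.proc s ω ≠ cem :=
    ((hk.right_cont 0).eventually_ne hk.start_ne).filter_mono (nhdsWithin_mono _ Ioi_subset_Ici_self)
  obtain ⟨s, hs, hs0⟩ := (hev.and self_mem_nhdsWithin).exists
  have hlt : Z.lifetime ω < (s : ℝ≥0∞) := by
    rw [h0]
    exact_mod_cast hs0
  obtain ⟨q, t, -, hts, ht⟩ := (Z.lifetime_lt_iff ω s).1 hlt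
  exact hs (hk.absorbed t s (by exact_mod_cast hts.le) ht)

/-- The regeneration times `S_n = ζ_0 + ⋯ + ζ_{n-1}`. -/
def regenTime (n : ℕ) (w : ℕ → Ω) : ℝ≥0∞ := ∑ i ∈ Finset.range n, Z.lifetime (w i)

theorem measurable_regenTime (n : ℕ) : Measurable (Z.regenTime n) := by
  unfold regenTime
  exact Finset.measurable_sum _ fun i _ => Z.measurable_lifetime.comp (measurable_pi_apply i)

theorem measurable_jumpChain_map : Measurable (fun p : (ℕ → Ω) × ℝ≥0 =>
    (Z.start (p.1 1), p.2 + (Z.lifetime (p.1 0)).toNNReal)) :=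
  (Z.measurable_start.comp ((measurable_pi_apply 1).comp measurable_fst)).prodMk
    (measurable_snd.add (Z.measurable_lifetime.comp
      ((measurable_pi_apply 0).comp measurable_fst)).ennreal_toNNReal)

variable [BorelSpace E]

theorem measurable_ambient :
    Measurable (fun p : ℝ≥0 × Ω => toAmbient (Z.start p.2) (Z.proc p.1 p.2)) := by
  have h : Measurable (fun q : X × Cem X => toAmbient q.1 q.2) := by
    refine (MeasurableEquiv.prodSumDistrib X X Unit).symm.measurable_comp_iff.1 ?_
    refine measurable_fun_sum ?_ ?_
    · exact measurable_subtype_coe.comp measurable_snd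
    · exact measurable_subtype_coe.comp measurable_fst
  exact h.comp ((Z.measurable_start.comp measurable_snd).prodMk Z.measurable_uncurry)

theorem measurable_preKill : Measurable Z.preKill := by
  let r : ℕ → ℝ≥0 := fun n => 1 / (n + 1)
  have hr : ∀ n, 0 < r n := fun n => by positivity
  have hr0 : Tendsto r atTop (𝓝 0) := tendsto_one_div_add_atTop_nhds_zero_nat (𝕜 := ℝ≥0)
  refine measurable_of_tendsto_metrizable
    (f := fun n ω => toAmbient (Z.start ω) (Z.proc ((Z.lifetime ω).toNNReal - r n) ω))
    (fun n => Z.measurable_ambient.comp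
      ((Z.measurable_lifetime.ennreal_toNNReal.sub_const _).prodMk measurable_id)) ?_
  refine tendsto_pi_nhds.2 fun ω => ?_
  rcases eq_or_ne (Z.lifetime ω).toNNReal 0 with h0 | h0
  · have hbot : 𝓝[<] (0 : ℝ≥0) = ⊥ := by
      have : Iio (0 : ℝ≥0) = ∅ := by ext; simp
      rw [this, nhdsWithin_empty]
    simp only [preKill, h0, zero_tsub, leftLim_eq_of_eq_bot _ hbot]
    exact tendsto_const_nhds
  · have hpos : 0 < (Z.lifetime ω).toNNReal := pos_iff_ne_zero.2 h0
    have hfin : Z.lifetime ω ≠ ∞ := fun h => h0 (by simp [h])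
    have halive : ∀ s < (Z.lifetime ω).toNNReal, Z.proc s ω ≠ cem := fun s hs hc => by
      have h1 : Z.lifetime ω ≤ (s : ℝ≥0∞) := iInf₂_le s hc
      rw [← ENNReal.coe_toNNReal hfin] at h1
      exact absurd hs (not_lt.2 (by exact_mod_cast h1))
    obtain ⟨l, hl, -⟩ := (Z.isKilledPath ω).left_lim _ hpos halive
    have hl := hl (Z.start ω)
    have hne : (𝓝[<] (Z.lifetime ω).toNNReal).NeBot := nhdsLT_neBot_of_exists_lt ⟨0, hpos⟩
    have e : Z.preKill ω = l := leftLim_eq_of_tendsto hl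
    rw [e]
    refine hl.comp (tendsto_nhdsWithin_iff.2 ⟨?_, Eventually.of_forall fun n => ?_⟩)
    · simpa using (tendsto_const_nhds (x := (Z.lifetime ω).toNNReal)).sub hr0
    · exact tsub_lt_self hpos (hr n)

/-! ### The regenerated process -/

/-- One step of the chain of excursions: given the excursion `ω`, sample a state from
`κ(X°(ζ-), ·)` and run a killed process from there. -/
def excursionStep (κ : Kernel E X) : Kernel Ω Ω :=
  (Z.law ∘ₖ κ).comap Z.preKill Z.measurable_preKill

instance (κ : Kernel E X) [IsMarkovKernel κ] : IsMarkovKernel (Z.excursionStep κ) := by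
  unfold excursionStep; infer_instance

/-- The law, given the starting point `x`, of the sequence `(X°_n, n ≥ 0)` of successive killed
processes: the first has law `ℙ_x`, and given the first `n + 1` of them the next one has the law
`excursionStep` (Ionescu-Tulcea). -/
def excursionLaw (κ : Kernel E X) [IsMarkovKernel κ] : Kernel X (ℕ → Ω) :=
  Kernel.traj (X := fun _ => Ω)
      (fun n => (Z.excursionStep κ).comap
        (fun h : (Finset.Iic n → Ω) => h ⟨n, Finset.mem_Iic.2 le_rfl⟩) (measurable_pi_apply _)) 0
    ∘ₖ Z.law.map (fun ω (_ : Finset.Iic 0) => ω)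

instance (κ : Kernel E X) [IsMarkovKernel κ] : IsMarkovKernel (Z.excursionLaw κ) := by
  have : IsMarkovKernel (Z.law.map (fun ω (_ : Finset.Iic 0) => ω)) :=
    Kernel.IsMarkovKernel.map _ (by fun_prop)
  unfold excursionLaw; infer_instance

open Classical in
/-- The regenerated process: `X^•(t) = X°_n(t - S_n)` for the `n` with `S_n ≤ t < S_{n+1}`
(the least `n` with `t < S_{n+1}`), and `X^•(t) = ∂` for `t ≥ S_∞ = sup_n S_n`. -/
def regen (t : ℝ≥0) (w : ℕ → Ω) : Cem X :=
  if h : ∃ n, (t : ℝ≥0∞) < Z.regenTime (n + 1) w then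
    Z.proc (t - (Z.regenTime (Nat.find h) w).toNNReal) (w (Nat.find h))
  else cem

/-- The transition kernels `P^•_t` of the regenerated process. -/
def regenTransition (κ : Kernel E X) [IsMarkovKernel κ] (t : ℝ≥0) : Kernel (Cem X) (Cem X) :=
  transitionOf Z.regen (Z.excursionLaw κ) t

theorem measurable_regen (t : ℝ≥0) : Measurable (Z.regen t) := by
  classical
  have hp : ∀ n, MeasurableSet {w : ℕ → Ω | (t : ℝ≥0∞) < Z.regenTime (n + 1) w} := fun n =>
    measurableSet_lt measurable_const (Z.measurable_regenTime _)
  have hs : MeasurableSet {w : ℕ → Ω | ∃ n, (t : ℝ≥0∞) < Z.regenTime (n + 1) w} := by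
    simpa only [ofPred_exists] using MeasurableSet.iUnion hp
  have hf : ∀ n, Measurable (fun w : ℕ → Ω => Z.proc (t - (Z.regenTime n w).toNNReal) (w n)) :=
    fun n => Z.measurable_uncurry.comp
      (((Z.measurable_regenTime n).ennreal_toNNReal.const_sub t).prodMk (measurable_pi_apply n))
  refine Measurable.dite (s := {w : ℕ → Ω | ∃ n, (t : ℝ≥0∞) < Z.regenTime (n + 1) w})
    (f := fun w => Z.proc (t - (Z.regenTime (Nat.find w.2) w).toNNReal) (w.1 (Nat.find w.2)))
    (g := fun _ => cem) ?_ measurable_const hs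
  exact Measurable.find
    (f := fun n (w : {w : ℕ → Ω | ∃ n, (t : ℝ≥0∞) < Z.regenTime (n + 1) w}) =>
      Z.proc (t - (Z.regenTime n w).toNNReal) (w.1 n))
    (p := fun n w => (t : ℝ≥0∞) < Z.regenTime (n + 1) w)
    (fun n => (hf n).comp measurable_subtype_coe)
    (fun n => measurable_subtype_coe (hp n)) (fun w => w.2)

/-- The kernel `P̃((x, s), ·) = ℙ_x((X^•(ζ), s + ζ) ∈ ·)` of the chain of regeneration states and
times; here `ζ = S_1` and `X^•(ζ) = X°_1(0)`. -/
def jumpChain (κ : Kernel E X) [IsMarkovKernel κ] : Kernel (X × ℝ≥0) (X × ℝ≥0) :=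
  (Z.excursionLaw κ ∥ₖ (Kernel.id : Kernel ℝ≥0 ℝ≥0)).map
    (fun p => (Z.start (p.1 1), p.2 + (Z.lifetime (p.1 0)).toNNReal))

end KilledMarkovProcess

end Killed

end Intertwining

end

namespace Intertwining

/-! Testing against functions `h` with `h ∂ = 0`, and regrouping `Λ P Φ Λ h = Λ P (ΦΛh)`, the
relation `Λ P = Q Λ` with `Q = Λ P Φ` says that `Λ P h` is unchanged when `h` is replaced by `ΦΛh`
(`intertwines_cemKernel_iff`).

At time `t` at most one excursion is running, so splitting over its index gives `P^•_t h (x) = ∑ₙ ∫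
P̃ⁿ((x, 0), d(z, s)) 1_{s ≤ t} P°_{t-s} h (z)` (`lintegral_regenTransition`). Integrate against
`Λ(y, ·)` and use `Λ̃ P̃ⁿ = Q̃ⁿ Λ̃` (`Intertwines.pow`): the `n`-th term becomes `∫ Q̃ⁿ((y, 0),
d(y', s)) 1_{s ≤ t} Λ P°_{t-s} h (y')`. Now `h` enters only through `Λ P°_{t-s} h`, which the killed
intertwining leaves unchanged under `h ↦ ΦΛh`. Hence so is `Λ P^•_t h`. No semigroup property of
`P^•` is needed. -/

theorem Intertwines.pow {S T : Type*} [MeasurableSpace S] [MeasurableSpace T] {Λ : Kernel T S}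
    {P : Kernel S S} {Q : Kernel T T} (h : Intertwines Λ P Q) (n : ℕ) :
    Intertwines Λ (P ^ n) (Q ^ n) := by
  unfold Intertwines at h ⊢
  induction n with
  | zero =>
    rw [pow_zero, pow_zero]
    exact (Kernel.id_comp Λ).trans (Kernel.comp_id Λ).symm
  | succ n ih =>
    rw [pow_succ', pow_succ']
    change (P ∘ₖ (P ^ n)) ∘ₖ Λ = Λ ∘ₖ (Q ∘ₖ (Q ^ n))
    rw [Kernel.comp_assoc, ih, ← Kernel.comp_assoc, h, Kernel.comp_assoc]

/-! ### Integration on spaces with a cemetery. -/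

section Cemetery

variable {A B : Type*} [MeasurableSpace A] [MeasurableSpace B]

@[simp]
theorem withCemetery_inl (k : Kernel A (Cem B)) (a : A) : withCemetery k (Sum.inl a) = k a := rfl

@[simp]
theorem cemKernel_cem (k : Kernel A B) : cemKernel k cem = Measure.dirac cem := rfl

theorem lintegral_cemKernel_inl (k : Kernel A B) (a : A) {h : Cem B → ℝ≥0∞} (hh : Measurable h) :
    ∫⁻ z, h z ∂cemKernel k (Sum.inl a) = ∫⁻ b, h (Sum.inl b) ∂k a := by
  rw [cemKernel, withCemetery_inl, Kernel.map_apply _ measurable_inl,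
    lintegral_map hh measurable_inl]

instance (k : Kernel A (Cem B)) [IsMarkovKernel k] : IsMarkovKernel (withCemetery k) :=
  ⟨by
    rintro (a | u)
    · exact inferInstanceAs (IsProbabilityMeasure (k a))
    · exact inferInstanceAs (IsProbabilityMeasure (Measure.dirac cem))⟩

instance (k : Kernel A B) [IsMarkovKernel k] : IsMarkovKernel (cemKernel k) := by
  have := Kernel.IsMarkovKernel.map k (measurable_inl : Measurable (Sum.inl : B → Cem B))
  unfold cemKernel
  infer_instance

/-- Two probability measures on `A ∪ {∂}` that give the same integrals to functions vanishing
at `∂` coincide. -/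
theorem ext_of_lintegral_vanishing_cem {μ ν : Measure (Cem A)} [IsProbabilityMeasure μ]
    [IsProbabilityMeasure ν]
    (h : ∀ g : Cem A → ℝ≥0∞, Measurable g → g cem = 0 → ∫⁻ z, g z ∂μ = ∫⁻ z, g z ∂ν) : μ = ν := by
  have key : ∀ S : Set (Cem A), MeasurableSet S → cem ∉ S → μ S = ν S := fun S hS hc => by
    simpa [lintegral_indicator_one hS] using
      h (S.indicator 1) (measurable_one.indicator hS) (by simp [hc])
  ext S hS
  by_cases hc : cem ∈ S
  -- Equal total masses recover the sets containing `∂` from their complements.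
  · have := key Sᶜ hS.compl (by simpa using hc)
    rwa [prob_compl_eq_one_sub hS, prob_compl_eq_one_sub hS,
      ENNReal.sub_right_inj ENNReal.one_ne_top prob_le_one prob_le_one] at this
  · exact key S hS hc

end Cemetery

/-! ### The killed process and the chain of excursions. -/

theorem transitionOf_inl {E : Type*} [MetricSpace E] [MeasurableSpace E] {X : Set E} {Ω : Type*}
    [MeasurableSpace Ω] (proc : ℝ≥0 → Ω → Cem X) (law : Kernel X Ω) (t : ℝ≥0)
    (hp : Measurable (proc t)) (x : X) :
    transitionOf proc law t (Sum.inl x) = (law x).map (proc t) :=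
  Kernel.map_apply _ hp _

namespace KilledMarkovProcess

variable {E : Type*} [MetricSpace E] [MeasurableSpace E] {X : Set E} {Ω : Type*}
  [MeasurableSpace Ω] (Z : KilledMarkovProcess X Ω)

/-- The infimum defining `ζ` is attained: by right-continuity and isolation of `∂`, a path alive at
`t` is still alive at some `s > t`, so absorption cannot have occurred before `s`. -/
theorem proc_eq_cem_iff (ω : Ω) (t : ℝ≥0) : Z.proc t ω = cem ↔ Z.lifetime ω ≤ t := by
  refine ⟨fun h => iInf₂_le t h, fun h => ?_⟩
  by_contra hne
  have hk := Z.isKilledPath ω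
  have hev : ∀ᶠ s in 𝓝[>] t, Z.proc s ω ≠ cem :=
    ((hk.right_cont t).eventually_ne hne).filter_mono (nhdsWithin_mono _ Ioi_subset_Ici_self)
  obtain ⟨s, hs, hst⟩ := (hev.and self_mem_nhdsWithin).exists
  obtain ⟨q, r, -, hrs, hr⟩ := (Z.lifetime_lt_iff ω s).1 (h.trans_lt (by exact_mod_cast hst))
  exact hs (hk.absorbed r s (by exact_mod_cast hrs.le) hr)

theorem start_ae_eq (x : X) : ∀ᵐ ω ∂Z.law x, Z.start ω = x := by
  filter_upwards [Z.start_eq x] with ω h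
  exact Sum.inl_injective ((Z.inl_start ω).trans h)

instance (t : ℝ≥0) : IsMarkovKernel (Z.transition t) := by
  have := Kernel.IsMarkovKernel.map Z.law (Z.measurable_proc t)
  unfold transition transitionOf
  infer_instance

theorem lintegral_transition_inl (t : ℝ≥0) (x : X) {h : Cem X → ℝ≥0∞} (hh : Measurable h) :
    ∫⁻ z, h z ∂Z.transition t (Sum.inl x) = ∫⁻ ω, h (Z.proc t ω) ∂Z.law x := by
  rw [transition, transitionOf_inl _ _ _ (Z.measurable_proc t),
    lintegral_map hh (Z.measurable_proc t)]

/-- Needed for regenerations exactly at time `t`, where the remaining time is `0`. -/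
theorem transition_zero : Z.transition 0 = Kernel.id := by
  ext1 z
  rcases z with x | u
  · rw [transition, transitionOf_inl _ _ _ (Z.measurable_proc 0), Kernel.id_apply,
      Measure.map_congr (Z.start_eq x), Measure.map_const, measure_univ, one_smul]
  · exact (Kernel.id_apply _).symm

/-- The sum of the first `n` lifetimes, with the value `0` in place of infinite lifetimes. -/
noncomputable def finiteRegenTime (n : ℕ) (w : ℕ → Ω) : ℝ≥0 :=
  ∑ i ∈ Finset.range n, (Z.lifetime (w i)).toNNReal

theorem finiteRegenTime_succ (n : ℕ) (w : ℕ → Ω) :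
    Z.finiteRegenTime (n + 1) w = Z.finiteRegenTime n w + (Z.lifetime (w n)).toNNReal :=
  Finset.sum_range_succ _ _

theorem measurable_finiteRegenTime (n : ℕ) : Measurable (Z.finiteRegenTime n) :=
  Finset.measurable_sum _ fun i _ =>
    (Z.measurable_lifetime.comp (measurable_pi_apply i)).ennreal_toNNReal

theorem coe_finiteRegenTime {w : ℕ → Ω} (hw : ∀ i, Z.lifetime (w i) < ∞) (n : ℕ) :
    (Z.finiteRegenTime n w : ℝ≥0∞) = Z.regenTime n w := by
  rw [finiteRegenTime, regenTime, ENNReal.ofNNReal_finsetSum]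
  exact Finset.sum_congr rfl fun i _ => ENNReal.coe_toNNReal (hw i).ne

variable [BorelSpace E] (κ : Kernel E X)

theorem lintegral_excursionStep (ω : Ω) {g : Ω → ℝ≥0∞} (hg : Measurable g) :
    ∫⁻ ω', g ω' ∂Z.excursionStep κ ω = ∫⁻ z, ∫⁻ ω', g ω' ∂Z.law z ∂κ (Z.preKill ω) := by
  rw [excursionStep, Kernel.comap_apply, Kernel.lintegral_comp _ _ _ hg]

/-- A killed process run from `z` starts at `z` almost surely, so the initial state of the next
excursion has the law from which `z` was sampled. -/
theorem lintegral_excursionStep_start (ω : Ω) {g : X → ℝ≥0∞} (hg : Measurable g) :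
    ∫⁻ ω', g (Z.start ω') ∂Z.excursionStep κ ω = ∫⁻ z, g z ∂κ (Z.preKill ω) := by
  refine (Z.lintegral_excursionStep κ ω (hg.comp Z.measurable_start)).trans ?_
  refine lintegral_congr fun z => ?_
  rw [lintegral_congr_ae (f := g ∘ Z.start) (g := fun _ => g z) ((Z.start_ae_eq z).mono fun ω' h => congrArg g h), lintegral_const,
    measure_univ, mul_one]

variable [IsMarkovKernel κ]

theorem excursionLaw_apply (x : X) : Z.excursionLaw κ x =
    Kernel.trajMeasure (X := fun _ => Ω) (Z.law x) (fun n => (Z.excursionStep κ).comap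
        (fun h : (Finset.Iic n → Ω) => h ⟨n, Finset.mem_Iic.2 le_rfl⟩) (measurable_pi_apply _)) := by
  rw [excursionLaw, Kernel.comp_apply, Kernel.map_apply _ (by fun_prop), Kernel.trajMeasure]
  rfl

/-- Markov property of the excursion chain. The whole past is kept in `F` because the regeneration
time depends on all earlier excursions. -/
theorem lintegral_excursionLaw_succ (x : X) (n : ℕ) {F : (Finset.Iic n → Ω) × Ω → ℝ≥0∞}
    (hF : Measurable F) :
    ∫⁻ w, F (Preorder.frestrictLe n w, w (n + 1)) ∂Z.excursionLaw κ x =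
      ∫⁻ w, ∫⁻ ω', F (Preorder.frestrictLe n w, ω') ∂Z.excursionStep κ (w n)
        ∂Z.excursionLaw κ x := by
  have h := Kernel.map_frestrictLe_trajMeasure_compProd_eq_map_trajMeasure
    (X := fun _ => Ω) (μ₀ := Z.law x) (κ := fun n => (Z.excursionStep κ).comap
        (fun h : (Finset.Iic n → Ω) => h ⟨n, Finset.mem_Iic.2 le_rfl⟩) (measurable_pi_apply _))
    (a := n)
  rw [← excursionLaw_apply] at h
  have h2 := congrArg (fun μ => ∫⁻ p, F p ∂μ) h
  rw [lintegral_map hF (by fun_prop), Measure.lintegral_compProd hF,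
    lintegral_map hF.lintegral_kernel_prod_right' (by fun_prop)] at h2
  exact h2.symm

theorem lintegral_excursionLaw_zero (x : X) {g : Ω → ℝ≥0∞} (hg : Measurable g) :
    ∫⁻ w, g (w 0) ∂Z.excursionLaw κ x = ∫⁻ ω, g ω ∂Z.law x := by
  have hm : Measurable fun h : Finset.Iic 0 → Ω => g (h ⟨0, Finset.mem_Iic.2 le_rfl⟩) :=
    hg.comp (measurable_pi_apply _)
  have hg0 : Measurable fun w : ℕ → Ω => g (w 0) := hg.comp (measurable_pi_apply 0)
  rw [excursionLaw, Kernel.lintegral_comp _ _ _ hg0,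
    Kernel.map_apply _ (by fun_prop),
    lintegral_map hg0.lintegral_kernel (by fun_prop)]
  refine lintegral_congr fun ω => ?_
  have h := Kernel.traj_map_frestrictLe_apply (X := fun _ => Ω)
    (κ := fun n => (Z.excursionStep κ).comap
        (fun h : (Finset.Iic n → Ω) => h ⟨n, Finset.mem_Iic.2 le_rfl⟩) (measurable_pi_apply _))
    0 0 (fun _ => ω)
  have h2 := congrArg (fun μ => ∫⁻ p, g (p ⟨0, Finset.mem_Iic.2 le_rfl⟩) ∂μ) h
  simp only [Kernel.partialTraj_self, Kernel.id_apply] at h2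
  rw [lintegral_map hm (by fun_prop), lintegral_dirac' _ hm] at h2
  exact h2

/-- Excursion `1` enters only through its initial state, so integrating it out leaves `κ` applied at
the pre-killing point of excursion `0`. -/
theorem lintegral_jumpChain (p : X × ℝ≥0) {g : X × ℝ≥0 → ℝ≥0∞} (hg : Measurable g) :
    ∫⁻ q, g q ∂Z.jumpChain κ p = ∫⁻ ω, ∫⁻ z, g (z, p.2 + (Z.lifetime ω).toNNReal)
      ∂κ (Z.preKill ω) ∂Z.law p.1 := by
  have hζ : Measurable fun ω => (Z.lifetime ω).toNNReal :=
    Z.measurable_lifetime.ennreal_toNNReal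
  have hm := Z.measurable_jumpChain_map
  have hgm := hg.comp hm
  simp only [Function.comp_def] at hgm
  have hF : Measurable fun q : (Finset.Iic 0 → Ω) × Ω =>
      g (Z.start q.2, p.2 + (Z.lifetime (q.1 ⟨0, Finset.mem_Iic.2 le_rfl⟩)).toNNReal) :=
    hg.comp ((Z.measurable_start.comp measurable_snd).prodMk
      (measurable_const.add (hζ.comp ((measurable_pi_apply _).comp measurable_fst))))
  have hκ : Measurable fun ω => ∫⁻ z, g (z, p.2 + (Z.lifetime ω).toNNReal) ∂κ (Z.preKill ω) :=
    Measurable.lintegral_kernel_prod_right' (κ := κ.comap Z.preKill Z.measurable_preKill)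
      (f := fun q : Ω × X => g (q.2, p.2 + (Z.lifetime q.1).toNNReal))
      (hg.comp (measurable_snd.prodMk (measurable_const.add (hζ.comp measurable_fst))))
  rw [jumpChain, Kernel.map_apply _ hm, lintegral_map hg hm,
    Kernel.lintegral_parallelComp _ hgm]
  have h1 : ∀ w : ℕ → Ω, ∫⁻ d, g (Z.start (w 1), d + (Z.lifetime (w 0)).toNNReal)
      ∂(Kernel.id : Kernel ℝ≥0 ℝ≥0) p.2 = g (Z.start (w 1), p.2 + (Z.lifetime (w 0)).toNNReal) :=
    fun w => lintegral_dirac' p.2 (hg.comp (measurable_const.prodMk (measurable_id.add_const _)))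
  simp only [h1]
  refine (Z.lintegral_excursionLaw_succ κ p.1 0 hF).trans ?_
  rw [← Z.lintegral_excursionLaw_zero κ p.1 hκ]
  exact lintegral_congr fun w => Z.lintegral_excursionStep_start κ (w 0)
    (g := fun z => g (z, p.2 + (Z.lifetime (w 0)).toNNReal))
    (hg.comp (measurable_id.prodMk measurable_const))

/-- The law of the `n`-th regeneration time and the `n`-th excursion. -/
theorem lintegral_finiteRegenTime_excursion (x : X) (n : ℕ) {F : ℝ≥0 × Ω → ℝ≥0∞}
    (hF : Measurable F) :
    ∫⁻ w, F (Z.finiteRegenTime n w, w n) ∂Z.excursionLaw κ x =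
      ∫⁻ p, ∫⁻ ω, F (p.2, ω) ∂Z.law p.1 ∂(Z.jumpChain κ ^ n) (x, 0) := by
  have hL : ∀ {G : ℝ≥0 × Ω → ℝ≥0∞}, Measurable G →
      Measurable fun p : X × ℝ≥0 => ∫⁻ ω, G (p.2, ω) ∂Z.law p.1 := fun {G} hG =>
    Measurable.lintegral_kernel_prod_right' (κ := Z.law.comap Prod.fst measurable_fst)
      (f := fun q : (X × ℝ≥0) × Ω => G (q.1.2, q.2)) (by fun_prop)
  have hζ : Measurable fun ω => (Z.lifetime ω).toNNReal :=
    Z.measurable_lifetime.ennreal_toNNReal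
  induction n generalizing F with
  | zero =>
    rw [pow_zero]
    change _ = ∫⁻ p, _ ∂(Kernel.id : Kernel (X × ℝ≥0) (X × ℝ≥0)) (x, 0)
    rw [Kernel.id_apply, lintegral_dirac' _ (hL hF)]
    exact Z.lintegral_excursionLaw_zero κ x (g := fun ω => F (0, ω)) (by fun_prop)
  | succ n ih =>
    -- The conditional expectation of `F` at index `n + 1`, given the `n`-th regeneration time and
    -- the `n`-th excursion.
    let F' : ℝ≥0 × Ω → ℝ≥0∞ := fun q =>
      ∫⁻ z, ∫⁻ ω', F (q.1 + (Z.lifetime q.2).toNNReal, ω') ∂Z.law z ∂κ (Z.preKill q.2)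
    have hF' : Measurable F' :=
      Measurable.lintegral_kernel_prod_right'
        (κ := κ.comap (fun q : ℝ≥0 × Ω => Z.preKill q.2)
          (Z.measurable_preKill.comp measurable_snd))
        (f := fun r : (ℝ≥0 × Ω) × X =>
          ∫⁻ ω', F (r.1.1 + (Z.lifetime r.1.2).toNNReal, ω') ∂Z.law r.2)
        ((hL hF).comp (measurable_snd.prodMk ((measurable_fst.comp measurable_fst).add
          (hζ.comp (measurable_snd.comp measurable_fst)))))
    -- The next regeneration time is a function of excursions `0, …, n`, hence fixed while excursion
    -- `n + 1` is sampled.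
    let τ : (Finset.Iic n → Ω) → ℝ≥0 := fun h => ∑ i : Finset.Iic n, (Z.lifetime (h i)).toNNReal
    have hτ : Measurable τ := Finset.measurable_sum _ fun i _ => hζ.comp (measurable_pi_apply i)
    have hτw : ∀ w : ℕ → Ω, Z.finiteRegenTime (n + 1) w = τ (Preorder.frestrictLe n w) :=
      fun w => by
        have e : Finset.range (n + 1) = Finset.Iic n := by ext; simp
        rw [finiteRegenTime, e, ← Finset.sum_coe_sort]
        rfl
    calc ∫⁻ w, F (Z.finiteRegenTime (n + 1) w, w (n + 1)) ∂Z.excursionLaw κ x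
        = ∫⁻ w, F (τ (Preorder.frestrictLe n w), w (n + 1)) ∂Z.excursionLaw κ x := by
          simp only [hτw]
      _ = ∫⁻ w, ∫⁻ ω', F (τ (Preorder.frestrictLe n w), ω') ∂Z.excursionStep κ (w n)
          ∂Z.excursionLaw κ x :=
          Z.lintegral_excursionLaw_succ κ x n (F := fun q => F (τ q.1, q.2))
            (hF.comp ((hτ.comp measurable_fst).prodMk measurable_snd))
      _ = ∫⁻ w, F' (Z.finiteRegenTime n w, w n) ∂Z.excursionLaw κ x := by
          refine lintegral_congr fun w => ?_
          rw [← hτw, finiteRegenTime_succ]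
          exact Z.lintegral_excursionStep κ (w n) (hF.comp measurable_prodMk_left)
      _ = _ := by
          rw [ih hF', pow_succ']
          change _ = ∫⁻ p, _ ∂(Z.jumpChain κ ∘ₖ (Z.jumpChain κ ^ n)) (x, 0)
          rw [Kernel.lintegral_comp _ _ _ (hL hF)]
          exact lintegral_congr fun p => (Z.lintegral_jumpChain κ p (hL hF)).symm

end KilledMarkovProcess

/-! ### Intertwining as invariance under `h ↦ ΦΛh`. -/

section Cemetery

variable {A B C : Type*} [MeasurableSpace A] [MeasurableSpace B] [MeasurableSpace C]

theorem lintegral_cemKernel_cem (k : Kernel A B) {h : Cem B → ℝ≥0∞} (hh : Measurable h) :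
    ∫⁻ z, h z ∂cemKernel k cem = h cem := by
  rw [cemKernel_cem, lintegral_dirac' _ hh]

theorem cemKernel_comp_cemKernel (k : Kernel B C) (l : Kernel A B) :
    cemKernel k ∘ₖ cemKernel l = cemKernel (k ∘ₖ l) := by
  refine Kernel.ext_fun fun a f hf => ?_
  rw [Kernel.lintegral_comp _ _ _ hf]
  rcases a with a | u
  · rw [lintegral_cemKernel_inl _ _ hf.lintegral_kernel, lintegral_cemKernel_inl _ _ hf]
    simp only [lintegral_cemKernel_inl _ _ hf]
    exact (Kernel.lintegral_comp _ _ _ (hf.comp measurable_inl)).symm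
  · rw [lintegral_cemKernel_cem _ hf.lintegral_kernel, lintegral_cemKernel_cem _ hf,
      lintegral_cemKernel_cem _ hf]

theorem cemKernel_id : cemKernel (Kernel.id : Kernel A A) = Kernel.id := by
  refine Kernel.ext_fun fun a f hf => ?_
  rw [Kernel.id_apply, lintegral_dirac' _ hf]
  rcases a with a | u
  · rw [lintegral_cemKernel_inl _ _ hf, Kernel.id_apply]
    exact lintegral_dirac' _ (hf.comp measurable_inl)
  · exact lintegral_cemKernel_cem _ hf

/-- The conditional expectation operator `ΦΛ` on functions. -/
noncomputable def condFun (Λ : Kernel B A) (Φ : Kernel A B) (g : Cem A → ℝ≥0∞) (u : Cem A) : ℝ≥0∞ :=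
  ∫⁻ v, ∫⁻ z, g z ∂cemKernel Λ v ∂cemKernel Φ u

theorem measurable_condFun (Λ : Kernel B A) (Φ : Kernel A B) {g : Cem A → ℝ≥0∞}
    (hg : Measurable g) : Measurable (condFun Λ Φ g) :=
  hg.lintegral_kernel.lintegral_kernel

theorem condFun_cem (Λ : Kernel B A) (Φ : Kernel A B) {g : Cem A → ℝ≥0∞} (hg : Measurable g) :
    condFun Λ Φ g cem = g cem := by
  rw [condFun, lintegral_cemKernel_cem _ hg.lintegral_kernel, lintegral_cemKernel_cem _ hg]

/-- Associativity moves the final `ΦΛ` from the kernels onto the test function. -/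
theorem lintegral_comp_projected (Λ : Kernel B A) (Φ : Kernel A B) (P : Kernel (Cem A) (Cem A))
    (a : Cem B) {g : Cem A → ℝ≥0∞} (hg : Measurable g) :
    ∫⁻ z, g z ∂(cemKernel Λ ∘ₖ projected (cemKernel Λ) P (cemKernel Φ)) a =
      ∫⁻ x, ∫⁻ u, condFun Λ Φ g u ∂P x ∂cemKernel Λ a := by
  rw [projected, Kernel.lintegral_comp _ _ _ hg, Kernel.lintegral_comp _ _ _ hg.lintegral_kernel]
  refine lintegral_congr fun x => ?_
  rw [Kernel.lintegral_comp _ _ _ hg.lintegral_kernel]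
  rfl

/-- Intertwining for kernels absorbed at `∂`, in terms of functions that vanish at `∂`. -/
theorem intertwines_cemKernel_iff (Λ : Kernel B A) [IsMarkovKernel Λ] (Φ : Kernel A B)
    [IsMarkovKernel Φ] (P : Kernel (Cem A) (Cem A)) [IsMarkovKernel P]
    (hP : P cem = Measure.dirac cem) :
    Intertwines (cemKernel Λ) P (projected (cemKernel Λ) P (cemKernel Φ)) ↔
      ∀ y, ∀ g : Cem A → ℝ≥0∞, Measurable g → g cem = 0 →
        ∫⁻ x, ∫⁻ z, g z ∂P (Sum.inl x) ∂Λ y =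
          ∫⁻ x, ∫⁻ z, condFun Λ Φ g z ∂P (Sum.inl x) ∂Λ y := by
  have hleft : ∀ y, ∀ g : Cem A → ℝ≥0∞, Measurable g →
      ∫⁻ z, g z ∂(P ∘ₖ cemKernel Λ) (Sum.inl y) = ∫⁻ x, ∫⁻ z, g z ∂P (Sum.inl x) ∂Λ y :=
    fun y g hg => by
      rw [Kernel.lintegral_comp _ _ _ hg, lintegral_cemKernel_inl _ _ hg.lintegral_kernel]
  have hright : ∀ y, ∀ g : Cem A → ℝ≥0∞, Measurable g →
      ∫⁻ z, g z ∂(cemKernel Λ ∘ₖ projected (cemKernel Λ) P (cemKernel Φ)) (Sum.inl y) =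
        ∫⁻ x, ∫⁻ z, condFun Λ Φ g z ∂P (Sum.inl x) ∂Λ y :=
    fun y g hg => by
      rw [lintegral_comp_projected _ _ _ _ hg,
        lintegral_cemKernel_inl _ _ (measurable_condFun Λ Φ hg).lintegral_kernel]
  have : IsMarkovKernel (projected (cemKernel Λ) P (cemKernel Φ)) := by
    unfold projected; infer_instance
  constructor
  · intro h y g hg _
    rw [← hleft y g hg, ← hright y g hg, h]
  · intro h
    refine Kernel.ext fun a => ?_
    rcases a with y | u
    · refine ext_of_lintegral_vanishing_cem fun g hg hg0 => ?_
      rw [hleft y g hg, hright y g hg, h y g hg hg0]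
    -- From `∂`, both sides are the point mass at `∂`.
    · refine Measure.ext_of_lintegral _ fun g hg => ?_
      rw [lintegral_comp_projected _ _ _ _ hg, Kernel.lintegral_comp _ _ _ hg,
        lintegral_cemKernel_cem _ hg.lintegral_kernel,
        lintegral_cemKernel_cem _ (measurable_condFun Λ Φ hg).lintegral_kernel, hP,
        lintegral_dirac' _ hg, lintegral_dirac' _ (measurable_condFun Λ Φ hg), condFun_cem _ _ hg]

end Cemetery

/-! ### Expansion of the regenerated process over its excursions. -/

namespace KilledMarkovProcess

variable {E : Type*} [MetricSpace E] [MeasurableSpace E] {X : Set E} {Ω : Type*}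
  [MeasurableSpace Ω] (Z : KilledMarkovProcess X Ω)

/-- Only the excursion running at time `t` contributes: earlier ones are already in `∂`, where `h`
vanishes, and later ones have not begun. If `t ≥ S_∞`, every excursion is over and both sides are
`0`. -/
theorem apply_regen_eq_tsum (t : ℝ≥0) {w : ℕ → Ω} (hw : ∀ i, Z.lifetime (w i) < ∞)
    {h : Cem X → ℝ≥0∞} (h0 : h cem = 0) :
    h (Z.regen t w) = ∑' n, if Z.finiteRegenTime n w ≤ t then
      h (Z.proc (t - Z.finiteRegenTime n w) (w n)) else 0 := by
  classical
  have hT := Z.coe_finiteRegenTime hw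
  have hiff : ∀ n, (t : ℝ≥0∞) < Z.regenTime n w ↔ t < Z.finiteRegenTime n w := fun n => by
    rw [← hT, ENNReal.coe_lt_coe]
  have hdead : ∀ n, ¬ (t : ℝ≥0∞) < Z.regenTime (n + 1) w →
      (if Z.finiteRegenTime n w ≤ t then
        h (Z.proc (t - Z.finiteRegenTime n w) (w n)) else 0) = 0 := fun n hn => by
    split_ifs with hle
    · rw [hiff, not_lt, finiteRegenTime_succ] at hn
      have : Z.proc (t - Z.finiteRegenTime n w) (w n) = cem := by
        rw [proc_eq_cem_iff, ← ENNReal.coe_toNNReal (hw n).ne, ENNReal.coe_le_coe]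
        exact le_tsub_of_add_le_left hn
      rw [this, h0]
    · rfl
  by_cases hex : ∃ n, (t : ℝ≥0∞) < Z.regenTime (n + 1) w
  · rw [regen, dif_pos hex, tsum_eq_single (Nat.find hex)]
    · have hle : Z.finiteRegenTime (Nat.find hex) w ≤ t := by
        rcases hm : Nat.find hex with _ | m
        · simp [finiteRegenTime]
        · have := Nat.find_min hex (m := m) (by omega)
          rwa [hiff, not_lt] at this
      rw [if_pos hle, ← hT, ENNReal.toNNReal_coe]
    · intro n hn
      rcases lt_or_gt_of_ne hn with hlt | hgt
      · exact hdead n (Nat.find_min hex hlt)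
      · refine if_neg (not_le.2 (((hiff _).1 (Nat.find_spec hex)).trans_le ?_))
        exact Finset.sum_le_sum_of_subset (Finset.range_mono (Nat.succ_le_of_lt hgt))
  · rw [regen, dif_neg hex, h0]
    simp only [not_exists] at hex
    simp only [fun n => hdead n (hex n), tsum_zero]

/-- The expectation of `h (X°(t - s))` for the process started from `z`, as a function of the
pair `(z, s)`, set to `0` for `s > t`. -/
noncomputable def shiftedExpectation (t : ℝ≥0) (h : Cem X → ℝ≥0∞) (p : X × ℝ≥0) : ℝ≥0∞ :=
  if p.2 ≤ t then ∫⁻ z, h z ∂Z.transition (t - p.2) (Sum.inl p.1) else 0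

variable [BorelSpace E] in
theorem measurable_shifted_proc (t : ℝ≥0) {h : Cem X → ℝ≥0∞} (hh : Measurable h) :
    Measurable fun q : ℝ≥0 × Ω => if q.1 ≤ t then h (Z.proc (t - q.1) q.2) else 0 :=
  Measurable.ite (measurableSet_le measurable_fst measurable_const)
    (hh.comp (Z.measurable_uncurry.comp ((measurable_fst.const_sub t).prodMk measurable_snd)))
    measurable_const

theorem shiftedExpectation_eq (t : ℝ≥0) {h : Cem X → ℝ≥0∞} (hh : Measurable h) (p : X × ℝ≥0) :
    Z.shiftedExpectation t h p =
      ∫⁻ ω, (if p.2 ≤ t then h (Z.proc (t - p.2) ω) else 0) ∂Z.law p.1 := by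
  unfold shiftedExpectation
  split_ifs
  · exact Z.lintegral_transition_inl _ _ hh
  · simp

variable [BorelSpace E] in
theorem measurable_shiftedExpectation (t : ℝ≥0) {h : Cem X → ℝ≥0∞} (hh : Measurable h) :
    Measurable (Z.shiftedExpectation t h) := by
  rw [funext (Z.shiftedExpectation_eq t hh)]
  exact Measurable.lintegral_kernel_prod_right' (κ := Z.law.comap Prod.fst measurable_fst)
    (f := fun q : (X × ℝ≥0) × Ω => if q.1.2 ≤ t then h (Z.proc (t - q.1.2) q.2) else 0)
    ((Z.measurable_shifted_proc t hh).comp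
      ((measurable_snd.comp measurable_fst).prodMk measurable_snd))

variable [BorelSpace E] (κ : Kernel E X) [IsMarkovKernel κ]

instance (t : ℝ≥0) : IsMarkovKernel (Z.regenTransition κ t) := by
  have := Kernel.IsMarkovKernel.map (Z.excursionLaw κ) (Z.measurable_regen t)
  unfold regenTransition transitionOf
  infer_instance

/-- The law of the `n`-th excursion is a mixture of the laws `ℙ_z`. There is no circularity:
`finiteRegenTime` and `jumpChain` both count an infinite lifetime as `0`, so
`lintegral_finiteRegenTime_excursion` does not presuppose finiteness. -/
theorem lifetime_lt_top_ae (x : X) : ∀ᵐ w ∂Z.excursionLaw κ x, ∀ i, Z.lifetime (w i) < ∞ := by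
  refine ae_all_iff.2 fun n => ?_
  have hS : MeasurableSet {ω | Z.lifetime ω = ∞} :=
    Z.measurable_lifetime (measurableSet_singleton ∞)
  have hF : Measurable fun q : ℝ≥0 × Ω => {ω | Z.lifetime ω = ∞}.indicator (1 : Ω → ℝ≥0∞) q.2 :=
    (measurable_one.indicator hS).comp measurable_snd
  have h := Z.lintegral_finiteRegenTime_excursion κ x n hF
  have hz : ∀ p : X × ℝ≥0, ∫⁻ ω, {ω | Z.lifetime ω = ∞}.indicator (1 : Ω → ℝ≥0∞) ω ∂Z.law p.1 = 0 :=
    fun p => by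
      rw [lintegral_indicator_one hS, measure_eq_zero_iff_ae_notMem]
      exact (Z.absorbed_ae p.1).mono fun ω h => h.ne
  simp only [hz, lintegral_zero] at h
  filter_upwards [(lintegral_eq_zero_iff
    ((measurable_one.indicator hS).comp (measurable_pi_apply n))).1 h] with w hw
  by_contra hc
  simp [top_le_iff.1 (not_lt.1 hc)] at hw

/-- Decomposition of the regenerated transition kernels over the excursions. -/
theorem lintegral_regenTransition (t : ℝ≥0) (x : X) {h : Cem X → ℝ≥0∞} (hh : Measurable h)
    (h0 : h cem = 0) :
    ∫⁻ z, h z ∂Z.regenTransition κ t (Sum.inl x) =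
      ∑' n : ℕ, ∫⁻ p, Z.shiftedExpectation t h p ∂(Z.jumpChain κ ^ n) (x, 0) := by
  have hF := Z.measurable_shifted_proc t hh
  rw [regenTransition, transitionOf_inl _ _ _ (Z.measurable_regen t),
    lintegral_map hh (Z.measurable_regen t),
    lintegral_congr_ae ((Z.lifetime_lt_top_ae κ x).mono fun w hw =>
      Z.apply_regen_eq_tsum t hw h0)]
  refine (lintegral_tsum fun n => (hF.comp
      ((Z.measurable_finiteRegenTime n).prodMk (measurable_pi_apply n))).aemeasurable).trans ?_
  refine tsum_congr fun n => ?_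
  refine (Z.lintegral_finiteRegenTime_excursion κ x n hF).trans ?_
  exact lintegral_congr fun p => (Z.shiftedExpectation_eq t hh p).symm

end KilledMarkovProcess

end Intertwining

/-! ### The intertwining of the regenerated process. -/

open Intertwining in
theorem mainTheorem12
    {E : Type*} [MetricSpace E] [MeasurableSpace E] [BorelSpace E]
    {X : Set E} (hX : MeasurableSet X)
    {Ω : Type*} [MeasurableSpace Ω] (Z : KilledMarkovProcess X Ω)
    (κ : Kernel E X) [IsMarkovKernel κ]
    {Y : Type*} [MetricSpace Y] [MeasurableSpace Y] [BorelSpace Y]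
    (φ : X → Y) (hφ : Measurable φ)
    (Λ : Kernel Y X) [IsMarkovKernel Λ]
    (hΛ : Kernel.deterministic φ hφ ∘ₖ Λ = Kernel.id)
    (hkilled : ∀ t : ℝ≥0, 0 < t →
      Intertwines (cemKernel Λ) (Z.transition t)
        (projected (cemKernel Λ) (Z.transition t) (cemKernel (Kernel.deterministic φ hφ))))
    (hjump :
      Intertwines (Λ ∥ₖ (Kernel.id : Kernel ℝ≥0 ℝ≥0)) (Z.jumpChain κ)
        (projected (Λ ∥ₖ (Kernel.id : Kernel ℝ≥0 ℝ≥0)) (Z.jumpChain κ)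
          (Kernel.deterministic (Prod.map φ id) (hφ.prodMap measurable_id)))) :
    ∀ t : ℝ≥0,
      Intertwines (cemKernel Λ) (Z.regenTransition κ t)
        (projected (cemKernel Λ) (Z.regenTransition κ t)
          (cemKernel (Kernel.deterministic φ hφ))) := by
  intro t
  -- Only the relation `Λ̃ P̃ = Q Λ̃` matters for taking powers, not the form of `Q`.
  generalize projected (Λ ∥ₖ (Kernel.id : Kernel ℝ≥0 ℝ≥0)) (Z.jumpChain κ)
    (Kernel.deterministic (Prod.map φ id) (hφ.prodMap measurable_id)) = Q at hjump
  have hkilled' : ∀ s, Intertwines (cemKernel Λ) (Z.transition s)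
      (projected (cemKernel Λ) (Z.transition s) (cemKernel (Kernel.deterministic φ hφ))) := by
    intro s
    rcases eq_or_ne s 0 with rfl | hs
    -- At time `0` the projected kernel is `ΛΦ`, which is the identity.
    · rw [Intertwines, projected, Z.transition_zero, Kernel.comp_id, Kernel.id_comp,
        cemKernel_comp_cemKernel, hΛ, cemKernel_id, Kernel.comp_id]
    · exact hkilled s (pos_iff_ne_zero.2 hs)
  rw [intertwines_cemKernel_iff _ _ _ rfl]
  intro y g hg hg0
  set g' := condFun Λ (Kernel.deterministic φ hφ) g
  have hg' : Measurable g' := measurable_condFun _ _ hg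
  have hg0' : g' cem = 0 := (condFun_cem _ _ hg).trans hg0
  have hpar : ∀ q : Y × ℝ≥0, ∀ {f : X × ℝ≥0 → ℝ≥0∞}, Measurable f →
      ∫⁻ p, f p ∂(Λ ∥ₖ (Kernel.id : Kernel ℝ≥0 ℝ≥0)) q = ∫⁻ x, f (x, q.2) ∂Λ q.1 :=
    fun q f hf => by
      rw [Kernel.lintegral_parallelComp _ hf]
      exact lintegral_congr fun x => lintegral_dirac' q.2 (hf.comp measurable_prodMk_left)
  -- Stated for general `h` so that it applies to both `g` and `g'`; the measures `Q ^ n` do not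
  -- depend on `h`, which allows a comparison term by term.
  have hexp : ∀ {h : Cem X → ℝ≥0∞}, Measurable h → h cem = 0 →
      ∫⁻ x, ∫⁻ z, h z ∂Z.regenTransition κ t (Sum.inl x) ∂Λ y =
        ∑' n : ℕ, ∫⁻ q, ∫⁻ p, Z.shiftedExpectation t h p
          ∂(Λ ∥ₖ (Kernel.id : Kernel ℝ≥0 ℝ≥0)) q
          ∂(Q ^ n) (y, 0) := by
    intro h hh h0
    have hm := Z.measurable_shiftedExpectation t hh
    simp only [Z.lintegral_regenTransition κ t _ hh h0]
    refine (lintegral_tsum fun n => ((hm.lintegral_kernel (κ := Z.jumpChain κ ^ n)).comp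
      measurable_prodMk_right).aemeasurable).trans ?_
    refine tsum_congr fun n => ?_
    have hn : (Z.jumpChain κ ^ n) ∘ₖ (Λ ∥ₖ Kernel.id) = (Λ ∥ₖ Kernel.id) ∘ₖ (Q ^ n) :=
      hjump.pow n
    rw [← Kernel.lintegral_comp _ _ _ hm, ← hn, Kernel.lintegral_comp _ _ _ hm,
      hpar _ hm.lintegral_kernel]
    rfl
  rw [hexp hg hg0, hexp hg' hg0']
  refine tsum_congr fun n => lintegral_congr fun q => ?_
  rw [hpar q (Z.measurable_shiftedExpectation t hg), hpar q (Z.measurable_shiftedExpectation t hg')]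
  unfold KilledMarkovProcess.shiftedExpectation
  by_cases hq : q.2 ≤ t
  · simp only [hq, if_true]
    -- The killed intertwining at the remaining time `t - q.2`, possibly `0`.
    exact (intertwines_cemKernel_iff _ _ _ rfl).1 (hkilled' _) q.1 g hg hg0
  · simp only [hq, if_false]
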